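/- A subset $S$ of a group $G$ invariably generates $G$ if $G=\langle s^{g(s)} \mid s\in S\rangle$ for every choice of elements $g(s)\in G$ ($s\in S$), where $s^{g}=g^{-1}sg$. For a finite group $G$, let $d(G)$ and $d_I(G)$ be the smallest cardinality of a generating set and of an invariably generating set of $G$, respectively, and let $\pi(G)$ be the set of primes dividing $|G|$. Theorem 3.1. Let $G$ be a nontrivial finite soluble group with $d(G)\le 2$. Then either $d_I(G)\ge \min\pi(G)$, or there exists a finite soluble group $H$ having $G$ as an epimorphic image such that (i) $d(H)=2$; (ii) $d_I(H)>d_I(G)$; (iii) $\min\pi(H)=\min\pi(G)$. Moreover, in the second case $H$ can be taken to be the wreath product $C_q\wr G$ with respect to the regular permutation representation of $G$, for some prime $q>\min\pi(G)$. -/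

import Mathlib

/-- A subset `S` of a group `G` invariably generates `G` if `G = ⟨s ^ g(s) ∣ s ∈ S⟩` for every
choice of elements `g(s) ∈ G`, `s ∈ S`, where `s ^ g = g⁻¹ s g`. -/
def InvariablyGenerates {G : Type*} [Group G] (S : Set G) : Prop :=
  ∀ g : G → G, Subgroup.closure ((fun s => (g s)⁻¹ * s * g s) '' S) = ⊤

/-- `d_I(G)`: the minimal cardinality of a subset invariably generating `G`
(it is `⊤` exactly when no finite subset invariably generates `G`; it is finite for finite `G`). -/
noncomputable def invariableRank (G : Type*) [Group G] : ℕ∞ :=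
  ⨅ (S : Set G) (_ : InvariablyGenerates S), S.encard

/-- `π(G)`: the set of primes dividing the order of the (finite) group `G`. -/
def primesDividingOrder (G : Type*) [Group G] : Set ℕ :=
  {p | p.Prime ∧ p ∣ Nat.card G}

universe u

/-! Assume `d_I(G) < p`, take a prime `q > |G|`, and write `H = C_q ≀ G` as pairs `(a, g)` with `a`
in the group algebra `F_q[G]`.

Growth of `d_I`: suppose at most `d_I(G)` elements invariably generate `H`. Their images in `G` are
nontrivial, since an identity could be dropped, so they have order at least `p`. As `q ∤ |G|`, each
element has a conjugate whose base component is a multiple of the norm element of `⟨g⟩`. Fewer than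
`p` such components impose fewer than `|G|` linear conditions on `w`, so some `w ≠ 0` is killed by
all of them, and the conjugates lie in the proper subgroup `annihilator w`.

Two generators: by Maschke `F_q[G]` is semisimple, hence of stable range one. This gives lifts of
`x, y` whose base components define no inner derivation in a nonzero quotient. A proper subgroup
containing the lifts would define one, because averaging makes every derivation inner. -/

/-! ### Unit-regularity and stable range one of semisimple rings -/

/-- An endomorphism `f` of a finite-dimensional space satisfies `f ∘ u ∘ f = f` for some
automorphism `u`. -/
theorem LinearMap.exists_linearEquiv_comp_comp_self {D V : Type*} [DivisionRing D] [AddCommGroup V]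
    [Module D V] [FiniteDimensional D V] (f : V →ₗ[D] V) :
    ∃ u : V ≃ₗ[D] V, ∀ x, f (u (f x)) = f x := by
  obtain ⟨C, hC⟩ := Submodule.exists_isCompl (LinearMap.ker f)
  obtain ⟨C', hC'⟩ := Submodule.exists_isCompl (LinearMap.range f)
  have h1 := Submodule.finrank_add_eq_of_isCompl hC'
  have h2 := LinearMap.finrank_range_add_finrank_ker f
  have h3 : Module.finrank D C' = Module.finrank D (LinearMap.ker f) := by omega
  let e : C' ≃ₗ[D] LinearMap.ker f := LinearEquiv.ofFinrankEq _ _ h3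
  let r : LinearMap.range f ≃ₗ[D] C :=
    f.quotKerEquivRange.symm ≪≫ₗ Submodule.quotientEquivOfIsCompl _ _ hC
  -- `u` inverts `f` from its range onto `C`, and maps `C'` onto the kernel, which has the same
  -- dimension.
  refine ⟨(Submodule.prodEquivOfIsCompl _ _ hC').symm ≪≫ₗ (r.prodCongr e) ≪≫ₗ
    Submodule.prodEquivOfIsCompl _ _ hC.symm, fun x => ?_⟩
  have hx : (Submodule.prodEquivOfIsCompl _ _ hC').symm (f x) =
      ((⟨f x, LinearMap.mem_range_self f x⟩ : LinearMap.range f), (0 : C')) :=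
    Submodule.prodEquivOfIsCompl_symm_apply_left _ _ hC' ⟨f x, LinearMap.mem_range_self f x⟩
  have hr : ∀ z : C, r ⟨f z, LinearMap.mem_range_self f z⟩ = z := by
    intro z
    have : f.quotKerEquivRange.symm ⟨f z, LinearMap.mem_range_self f z⟩ =
        Submodule.Quotient.mk (z : V) := by
      rw [LinearEquiv.symm_apply_eq]; rfl
    simp only [r, LinearEquiv.trans_apply, this]
    exact Submodule.quotientEquivOfIsCompl_apply_mk_right hC z
  obtain ⟨z, hz⟩ : ∃ z : C, f z = f x := by
    have : x ∈ LinearMap.ker f ⊔ C := by rw [hC.sup_eq_top]; trivial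
    obtain ⟨k, hk, z, hz, rfl⟩ := Submodule.mem_sup.1 this
    exact ⟨⟨z, hz⟩, by simp [LinearMap.mem_ker.1 hk]⟩
  rw [LinearEquiv.trans_apply, LinearEquiv.trans_apply, hx]
  simp [← hz, hr]

theorem Matrix.exists_isUnit_mul_mul_self {D n : Type*} [DivisionRing D] [Fintype n]
    [DecidableEq n] (a : Matrix n n D) : ∃ u : Matrix n n D, IsUnit u ∧ a * u * a = a := by
  obtain ⟨u, hu⟩ := (Matrix.toLinearMapRight' a).exists_linearEquiv_comp_comp_self
  set φ := Matrix.toLinearMapRight' (R := D) (m := n) (n := n)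
  have hφ : ∀ x y, φ (x * y) = φ y ∘ₗ φ x := fun x y => Matrix.toLinearMapRight'_mul x y
  have h1 : φ 1 = LinearMap.id := Matrix.toLinearMapRight'_one
  refine ⟨φ.symm u, ⟨⟨φ.symm u, φ.symm u.symm, ?_, ?_⟩, rfl⟩, ?_⟩
  · apply φ.injective; rw [hφ, h1]; ext; simp
  · apply φ.injective; rw [hφ, h1]; ext; simp
  · apply φ.injective; rw [hφ, hφ]
    refine LinearMap.ext fun x => ?_
    simpa using hu x

/-- Semisimple rings are unit-regular. -/
theorem IsSemisimpleRing.exists_isUnit_mul_mul_self {R : Type*} [Ring R] [IsSemisimpleRing R]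
    (a : R) : ∃ u : R, IsUnit u ∧ a * u * a = a := by
  obtain ⟨n, D, d, _, _, ⟨e⟩⟩ := IsSemisimpleRing.exists_ringEquiv_pi_matrix_divisionRing R
  choose u hu hua using fun i => Matrix.exists_isUnit_mul_mul_self (e a i)
  refine ⟨e.symm u, (Pi.isUnit_iff.2 hu).map e.symm, e.injective ?_⟩
  ext1 i
  simpa using hua i

/-- Semisimple rings have stable range one. -/
theorem IsSemisimpleRing.exists_isUnit_add_mul {R : Type*} [Ring R] [IsSemisimpleRing R]
    {a b r s : R} (h : r * a + s * b = 1) : ∃ t : R, IsUnit (a + t * b) := by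
  obtain ⟨_, ⟨u, rfl⟩, hu⟩ := IsSemisimpleRing.exists_isUnit_mul_mul_self a
  set f : R := u * a with hf
  have hff : f * f = f := by rw [hf, mul_assoc, ← mul_assoc a, hu]
  have haf : a * (1 - f) = 0 := by rw [mul_sub, hf, ← mul_assoc, hu, mul_one, sub_self]
  have hb : s * b * (1 - f) = 1 - f := by
    calc s * b * (1 - f) = r * (a * (1 - f)) + s * b * (1 - f) := by rw [haf]; simp
      _ = (r * a + s * b) * (1 - f) := by noncomm_ring
      _ = 1 - f := by rw [h, one_mul]
  have hf1 : f * (1 - f) = 0 := by rw [mul_sub, hff, mul_one, sub_self]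
  have hf2 : (1 - f) * f = 0 := by rw [sub_mul, hff, one_mul, sub_self]
  have hf3 : (1 - f) * (1 - f) = 1 - f := by rw [mul_sub, hf2, mul_one, sub_zero]
  set z : R := (1 - f) * (s * b) * f with hz
  have hzz : z * z = 0 := by
    calc z * z = (1 - f) * (s * b) * (f * (1 - f)) * (s * b) * f := by rw [hz]; noncomm_ring
      _ = 0 := by rw [hf1]; simp
  have key : f + (1 - f) * (s * b) = 1 + z := by
    calc f + (1 - f) * (s * b) = f + (1 - f) * (s * b * (1 - f)) + z := by rw [hz]; noncomm_ring
      _ = 1 + z := by rw [hb, hf3]; abel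
  -- Chosen so that `u * (a + t * b) = f + (1 - f) * s * b = 1 + z`, a unit because `z * z = 0`.
  refine ⟨↑u⁻¹ * (1 - f) * s, ?_⟩
  have h1 : a + ↑u⁻¹ * (1 - f) * s * b = ↑u⁻¹ * (1 + z) := by
    rw [← key, mul_add, hf, Units.inv_mul_cancel_left]; simp only [mul_assoc]
  rw [h1]
  refine u⁻¹.isUnit.mul ⟨⟨1 + z, 1 - z, ?_, ?_⟩, rfl⟩
  · calc (1 + z) * (1 - z) = 1 - z * z := by noncomm_ring
      _ = 1 := by rw [hzz, sub_zero]
  · calc (1 - z) * (1 + z) = 1 - z * z := by noncomm_ring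
      _ = 1 := by rw [hzz, sub_zero]

/-! ### The wreath product as a semidirect product with the group algebra -/

namespace RegularWreathProduct

variable {R G : Type*} [Ring R]

open MonoidAlgebra

/-- The element of the wreath product `R ≀ᵣ G` of the additive group of `R` with `G` whose base
component is the element `a` of the group algebra and whose top component is `g`. -/
noncomputable def ofMonoidAlgebra (a : MonoidAlgebra R G) (g : G) :
    RegularWreathProduct (Multiplicative R) G :=
  ⟨fun x => Multiplicative.ofAdd (a.coeff x), g⟩

theorem ofMonoidAlgebra_injective {a b : MonoidAlgebra R G} {g h : G}
    (hab : ofMonoidAlgebra a g = ofMonoidAlgebra b h) : a = b := by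
  have := congrArg RegularWreathProduct.left hab
  ext x
  exact Multiplicative.ofAdd.injective (congrFun this x)

theorem exists_eq_ofMonoidAlgebra [Finite G] (h : RegularWreathProduct (Multiplicative R) G) :
    ∃ a : MonoidAlgebra R G, h = ofMonoidAlgebra a h.right := by
  refine ⟨.ofCoeff (Finsupp.equivFunOnFinite.symm fun x => (h.left x).toAdd), ?_⟩
  refine RegularWreathProduct.ext ?_ rfl
  funext x
  simp [ofMonoidAlgebra]

variable [Group G]

theorem ofMonoidAlgebra_mul (a b : MonoidAlgebra R G) (g h : G) :
    ofMonoidAlgebra a g * ofMonoidAlgebra b h = ofMonoidAlgebra (a + of R G g * b) (g * h) := by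
  refine RegularWreathProduct.ext ?_ rfl
  funext x
  simp [ofMonoidAlgebra]

theorem ofMonoidAlgebra_zero_one : ofMonoidAlgebra (0 : MonoidAlgebra R G) 1 = 1 := by
  refine RegularWreathProduct.ext ?_ rfl
  funext x
  simp [ofMonoidAlgebra]

theorem ofMonoidAlgebra_inv (a : MonoidAlgebra R G) (g : G) :
    (ofMonoidAlgebra a g)⁻¹ = ofMonoidAlgebra (-(of R G g⁻¹ * a)) g⁻¹ := by
  rw [inv_eq_iff_mul_eq_one, ofMonoidAlgebra_mul, mul_neg, ← mul_assoc, ← map_mul, mul_inv_cancel,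
    map_one, one_mul, add_neg_cancel, ofMonoidAlgebra_zero_one]

/-- The elements of the wreath product whose base component annihilates `w`. -/
noncomputable def annihilator (w : MonoidAlgebra R G) :
    Subgroup (RegularWreathProduct (Multiplicative R) G) where
  carrier := {h | ∃ a g, h = ofMonoidAlgebra a g ∧ a * w = 0}
  one_mem' := ⟨0, 1, ofMonoidAlgebra_zero_one.symm, zero_mul w⟩
  mul_mem' := by
    rintro _ _ ⟨a, g, rfl, ha⟩ ⟨b, h, rfl, hb⟩
    exact ⟨_, _, ofMonoidAlgebra_mul a b g h, by rw [add_mul, ha, mul_assoc, hb]; simp⟩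
  inv_mem' := by
    rintro _ ⟨a, g, rfl, ha⟩
    exact ⟨_, _, ofMonoidAlgebra_inv a g, by rw [neg_mul, mul_assoc, ha]; simp⟩

theorem annihilator_ne_top {w : MonoidAlgebra R G} (hw : w ≠ 0) : annihilator w ≠ ⊤ := by
  intro h
  obtain ⟨a, g, hag, ha⟩ : ofMonoidAlgebra (1 : MonoidAlgebra R G) 1 ∈ annihilator w := by
    rw [h]; trivial
  rw [← ofMonoidAlgebra_injective hag, one_mul] at ha
  exact hw ha

end RegularWreathProduct

/-! ### Norm elements of cyclic subgroups -/

namespace MonoidAlgebra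

variable {R G : Type*} [Field R] [Group G]

theorem of_mul_geom_sum_orderOf (g k : G) (hk : k ∈ Subgroup.zpowers g) :
    of R G k * ∑ i ∈ Finset.range (orderOf g), of R G g ^ i =
      ∑ i ∈ Finset.range (orderOf g), of R G g ^ i := by
  set N := ∑ i ∈ Finset.range (orderOf g), of R G g ^ i with hN
  have h1 : of R G g * N = N := by
    have := mul_geom_sum (of R G g) (orderOf g)
    rw [← map_pow, pow_orderOf_eq_one, map_one, sub_self, sub_mul, one_mul, sub_eq_zero] at this
    exact this
  have h2 : ∀ j : ℤ, of R G (g ^ j) * N = N := by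
    intro j
    induction j with
    | zero => rw [zpow_zero, map_one, one_mul]
    | succ j ih => rw [zpow_add_one, map_mul, mul_assoc, h1, ih]
    | pred j ih =>
      rw [zpow_sub_one, map_mul, mul_assoc]
      nth_rw 1 [← h1]
      rw [← mul_assoc (of R G g⁻¹), ← map_mul, inv_mul_cancel, map_one, one_mul, ih]
  obtain ⟨j, rfl⟩ := Subgroup.mem_zpowers_iff.1 hk
  exact h2 j

/-- If `|g|` is invertible, every element agrees modulo the image of `1 - g` with a multiple of
the norm element of `⟨g⟩`. -/
theorem exists_neg_add_add_eq_smul_geom_sum_mul (m : MonoidAlgebra R G) (g : G)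
    (hg : (orderOf g : R) ≠ 0) :
    ∃ c : MonoidAlgebra R G, -c + m + of R G g * c =
      (orderOf g : R)⁻¹ • ((∑ i ∈ Finset.range (orderOf g), of R G g ^ i) * m) := by
  set n := orderOf g
  set x := of R G g
  -- A discrete antiderivative: `x - 1` sends the inner sum to `(x ^ j - 1) * m`, and averaging over
  -- `j` leaves the norm term minus `m`.
  refine ⟨(n : R)⁻¹ • ∑ j ∈ Finset.range n, (∑ i ∈ Finset.range j, x ^ i) * m, ?_⟩
  have h1 : x * ((n : R)⁻¹ • ∑ j ∈ Finset.range n, (∑ i ∈ Finset.range j, x ^ i) * m) -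
      ((n : R)⁻¹ • ∑ j ∈ Finset.range n, (∑ i ∈ Finset.range j, x ^ i) * m) =
      (n : R)⁻¹ • ((∑ i ∈ Finset.range n, x ^ i) * m) - m := by
    have h2 : m = (n : R)⁻¹ • ∑ j ∈ Finset.range n, m := by
      rw [Finset.sum_const, Finset.card_range, ← Nat.cast_smul_eq_nsmul R, inv_smul_smul₀ hg]
    nth_rw 4 [h2]
    rw [mul_smul_comm, ← smul_sub, ← smul_sub, Finset.mul_sum, Finset.sum_mul,
      ← Finset.sum_sub_distrib, ← Finset.sum_sub_distrib]
    congr 1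
    refine Finset.sum_congr rfl fun j _ => ?_
    calc _ = ((x - 1) * ∑ i ∈ Finset.range j, x ^ i) * m := by noncomm_ring
      _ = _ := by rw [mul_geom_sum, sub_mul, one_mul]
  rw [← sub_eq_zero] at h1 ⊢
  rw [← h1]
  abel

/-- If `∑ |G| / |g i| < |G|`, then some nonzero `w` is annihilated by all the products of the norm
element of `⟨g i⟩` with `m i`. -/
theorem exists_ne_zero_geom_sum_mul_mul_eq_zero [Finite G] {ι : Type*} [Finite ι]
    (m : ι → MonoidAlgebra R G) (g : ι → G) (p : ℕ) (hp : ∀ i, p ≤ orderOf (g i))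
    (hι : Nat.card ι < p) :
    ∃ w : MonoidAlgebra R G, w ≠ 0 ∧
      ∀ i, (∑ j ∈ Finset.range (orderOf (g i)), of R G (g i) ^ j) * m i * w = 0 := by
  classical
  have := Fintype.ofFinite ι
  have := Fintype.ofFinite G
  set N : ι → MonoidAlgebra R G := fun i => ∑ j ∈ Finset.range (orderOf (g i)), of R G (g i) ^ j
  -- `N i * m i * w` is fixed by left multiplication by `⟨g i⟩`, so one coefficient per right coset
  -- determines it; inverting `out` turns left coset representatives into right ones.
  let Φ : MonoidAlgebra R G →ₗ[R] ((Σ i, G ⧸ Subgroup.zpowers (g i)) → R) :=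
    { toFun := fun w c => (N c.1 * m c.1 * w).coeff (c.2.out⁻¹)
      map_add' := fun a b => by ext c; simp [mul_add]
      map_smul' := fun r a => by ext c; simp }
  have hlt : Module.finrank R ((Σ i, G ⧸ Subgroup.zpowers (g i)) → R) <
      Module.finrank R (MonoidAlgebra R G) := by
    rw [(MonoidAlgebra.coeffLinearEquiv R).finrank_eq, Module.finrank_finsupp_self,
      Module.finrank_fintype_fun_eq_card, ← Nat.card_eq_fintype_card, ← Nat.card_eq_fintype_card,
      Nat.card_sigma]
    have hG : 0 < Nat.card G := Nat.card_pos
    have h1 : p * ∑ i, Nat.card (G ⧸ Subgroup.zpowers (g i)) ≤ Nat.card ι * Nat.card G := by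
      rw [Finset.mul_sum, Nat.card_eq_fintype_card (α := ι), ← Finset.card_univ, ← smul_eq_mul,
        ← Finset.sum_const]
      refine Finset.sum_le_sum fun i _ => ?_
      rw [Subgroup.card_eq_card_quotient_mul_card_subgroup (Subgroup.zpowers (g i)),
        Nat.card_zpowers, mul_comm]
      exact Nat.mul_le_mul_left _ (hp i)
    have h2 : Nat.card ι * Nat.card G < p * Nat.card G := Nat.mul_lt_mul_of_pos_right hι hG
    exact Nat.lt_of_mul_lt_mul_left (h1.trans_lt h2)
  obtain ⟨w, hw, hw0⟩ := Submodule.exists_mem_ne_zero_of_ne_bot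
    (LinearMap.ker_ne_bot_of_finrank_lt (f := Φ) hlt)
  refine ⟨w, hw0, fun i => ?_⟩
  ext z
  obtain ⟨k, hk⟩ := QuotientGroup.mk_out_eq_mul (Subgroup.zpowers (g i)) z⁻¹
  have h1 : (N i * m i * w).coeff (((z⁻¹ : G) : G ⧸ Subgroup.zpowers (g i)).out⁻¹) = 0 :=
    congrFun (LinearMap.mem_ker.1 hw) ⟨i, ((z⁻¹ : G) : G ⧸ Subgroup.zpowers (g i))⟩
  have h2 : of R G k * (N i * m i * w) = N i * m i * w := by
    rw [← mul_assoc, ← mul_assoc, of_mul_geom_sum_orderOf _ _ k.2]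
  rw [hk] at h1
  change (N i * m i * w).coeff z = 0
  rw [← h2, ← h1]
  simp

end MonoidAlgebra

/-! ### Invariable generation in quotients and in wreath products -/

theorem InvariablyGenerates.image {G H : Type*} [Group G] [Group H] {S : Set H}
    (hS : InvariablyGenerates S) {f : H →* G} (hf : Function.Surjective f) :
    InvariablyGenerates (f '' S) := by
  intro g
  choose r hr using hf
  have h := congrArg (Subgroup.map f) (hS fun s => r (g (f s)))
  rw [MonoidHom.map_closure, Subgroup.map_top_of_surjective f fun x => ⟨_, hr x⟩] at h
  rw [← h, Set.image_image, Set.image_image]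
  simp [hr]

theorem InvariablyGenerates.diff_one {G : Type*} [Group G] {S : Set G}
    (hS : InvariablyGenerates S) : InvariablyGenerates (S \ {1}) := by
  intro g
  rw [eq_top_iff, ← hS g, Subgroup.closure_le]
  rintro _ ⟨s, hs, rfl⟩
  by_cases h1 : s = 1
  · simp [h1]
  · exact Subgroup.subset_closure ⟨s, ⟨hs, h1⟩, rfl⟩

theorem invariableRank_le {G : Type*} [Group G] {S : Set G} (hS : InvariablyGenerates S) :
    invariableRank G ≤ S.encard :=
  iInf₂_le S hS

namespace RegularWreathProduct

/-- Fewer than `p` elements of `R ≀ᵣ G`, all of whose top components have order at least `p`, do not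
invariably generate. -/
theorem not_invariablyGenerates_of_le_orderOf {R G : Type*} [Field R] [Group G] [Finite G]
    (hR : (Nat.card G : R) ≠ 0) {S : Set (RegularWreathProduct (Multiplicative R) G)} {p : ℕ}
    (hp : ∀ s ∈ S, p ≤ orderOf s.right) (hS : S.encard < p) : ¬ InvariablyGenerates S := by
  intro hI
  have hfin : S.Finite := Set.finite_of_encard_le_coe hS.le
  have := hfin.to_subtype
  have hcard : Nat.card S < p := by
    rw [Nat.card_coe_set_eq, ← Nat.cast_lt (α := ℕ∞), hfin.cast_ncard_eq]; exact hS
  choose m hm using exists_eq_ofMonoidAlgebra (R := R) (G := G)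
  obtain ⟨w, hw0, hw⟩ := MonoidAlgebra.exists_ne_zero_geom_sum_mul_mul_eq_zero
    (fun s : S => m s) (fun s => s.1.right) p (fun s => hp s s.2) hcard
  have hord : ∀ g : G, (orderOf g : R) ≠ 0 := fun g h => hR <| by
    obtain ⟨k, hk⟩ := orderOf_dvd_natCard g
    rw [hk, Nat.cast_mul, h, zero_mul]
  choose c hc using fun s => MonoidAlgebra.exists_neg_add_add_eq_smul_geom_sum_mul (m s) s.right
    (hord s.right)
  refine annihilator_ne_top hw0 ?_
  -- Conjugating `(m, g)` by `(c, 1)` gives `(-c + m + g * c, g)`.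
  rw [eq_top_iff, ← hI fun s => ofMonoidAlgebra (c s) 1, Subgroup.closure_le]
  rintro _ ⟨s, hs, rfl⟩
  refine ⟨(orderOf s.right : R)⁻¹ • ((∑ i ∈ Finset.range (orderOf s.right),
    MonoidAlgebra.of R G s.right ^ i) * m s), s.right, ?_, ?_⟩
  · rw [← hc]
    dsimp only
    nth_rw 2 [hm s]
    rw [ofMonoidAlgebra_inv, ofMonoidAlgebra_mul, ofMonoidAlgebra_mul, inv_one, map_one, one_mul,
      one_mul, one_mul, mul_one]
  · rw [smul_mul_assoc, hw ⟨s, hs⟩, smul_zero]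

theorem invariableRank_lt {R G : Type*} [Field R] [Group G] [Finite G]
    (hR : (Nat.card G : R) ≠ 0) {p : ℕ} (hp : ∀ g : G, g ≠ 1 → p ≤ orderOf g)
    (hG : invariableRank G < p) :
    invariableRank G < invariableRank (RegularWreathProduct (Multiplicative R) G) := by
  rw [← ENat.add_one_le_iff hG.ne_top]
  refine le_iInf₂ fun S hS => ?_
  rw [ENat.add_one_le_iff hG.ne_top]
  by_contra! hle
  have hT := hS.image (f := rightHom) fun g => ⟨inl g, rfl⟩
  set T := (rightHom : RegularWreathProduct (Multiplicative R) G →* G) '' S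
  have hTS : T.encard ≤ S.encard := Set.encard_image_le _ _
  -- Removing `1` from `T` would invariably generate `G` with fewer than `invariableRank G`
  -- elements.
  have h1 : (1 : G) ∉ T := fun h1 => by
    have h2 := Set.encard_sdiff_singleton_add_one h1
    have h3 := invariableRank_le hT.diff_one
    have h4 : invariableRank G + 1 ≤ invariableRank G :=
      (add_le_add_left h3 1).trans (h2.le.trans (hTS.trans hle))
    rw [ENat.add_one_le_iff hG.ne_top] at h4
    exact lt_irrefl _ h4
  exact not_invariablyGenerates_of_le_orderOf hR
    (fun s hs => hp _ fun h => h1 ⟨s, hs, h⟩) (hle.trans_lt hG) hS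

end RegularWreathProduct

/-! ### Base components for two generators -/

namespace MonoidAlgebra

variable {R G : Type*} [Field R] [Group G]

/-- If `x` and `y` generate `G`, then `x - 1 + e` and `y - 1` generate the group algebra as a left
ideal, where `e` is the average of the group elements. -/
theorem exists_mul_add_mul_eq_one [Fintype G] (hR : (Fintype.card G : R) ≠ 0) {x y : G}
    (hxy : Subgroup.closure {x, y} = ⊤) {e : MonoidAlgebra R G}
    (he : e = (Fintype.card G : R)⁻¹ • ∑ g, of R G g)
    (hleft : ∀ g, of R G g * e = e) (hright : ∀ g, e * of R G g = e) :
    ∃ r s : MonoidAlgebra R G, r * (of R G x - 1 + e) + s * (of R G y - 1) = 1 := by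
  have hee : e * e = e := by
    nth_rw 1 [he]
    rw [smul_mul_assoc, Finset.sum_mul, Finset.sum_congr rfl fun g _ => hleft g, Finset.sum_const,
      Finset.card_univ, ← Nat.cast_smul_eq_nsmul R, inv_smul_smul₀ hR]
  let J : Submodule (MonoidAlgebra R G) (MonoidAlgebra R G) :=
    Submodule.span _ {of R G x - 1 + e, of R G y - 1}
  have h1 : of R G x - 1 + e ∈ J := Submodule.subset_span (by simp)
  have hy : of R G y - 1 ∈ J := Submodule.subset_span (by simp)
  -- Multiplying by `e` kills `x - 1`, leaving `e * e = e`.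
  have heJ : e ∈ J := by
    have := J.smul_mem e h1
    rwa [smul_eq_mul, mul_add, mul_sub, hright, mul_one, hee, sub_self, zero_add] at this
  have hx : of R G x - 1 ∈ J := by simpa using J.sub_mem h1 heJ
  have hall : ∀ g, of R G g - 1 ∈ J := by
    intro g
    have hg : g ∈ Subgroup.closure {x, y} := by rw [hxy]; trivial
    induction hg using Subgroup.closure_induction with
    | mem z hz => rcases hz with rfl | rfl <;> assumption
    | one => rw [map_one, sub_self]; exact J.zero_mem
    | mul a b _ _ ha hb =>
      have := J.add_mem (J.smul_mem (of R G a) hb) ha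
      rwa [smul_eq_mul, mul_sub, mul_one, ← map_mul, sub_add_sub_cancel] at this
    | inv a _ ha =>
      have := J.smul_mem (-of R G a⁻¹) ha
      rwa [smul_eq_mul, neg_mul, mul_sub, mul_one, ← map_mul, inv_mul_cancel, map_one,
        neg_sub] at this
  have hone : (1 : MonoidAlgebra R G) ∈ J := by
    have h2 : e - 1 = (Fintype.card G : R)⁻¹ • ∑ g, (of R G g - 1) := by
      rw [Finset.sum_sub_distrib, smul_sub, ← he, Finset.sum_const, Finset.card_univ,
        ← Nat.cast_smul_eq_nsmul R, inv_smul_smul₀ hR]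
    have h3 : e - 1 ∈ J := by
      rw [h2]
      exact Submodule.smul_of_tower_mem J _ (J.sum_mem fun g _ => hall g)
    simpa using J.sub_mem heJ h3
  exact Submodule.mem_span_pair.1 hone

/-- A two-generator group has elements `a`, `b` of its group algebra such that the derivations
given on the generators by right multiples of `a` and `b` are inner only trivially. -/
theorem exists_forall_eq_zero_of_mul_eq_sub_one_mul [Finite G] (hR : (Nat.card G : R) ≠ 0)
    {x y : G} (hxy : Subgroup.closure {x, y} = ⊤) :
    ∃ a b : MonoidAlgebra R G, ∀ v w : MonoidAlgebra R G,
      a * w = (of R G x - 1) * v → b * w = (of R G y - 1) * v → w = 0 := by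
  have := Fintype.ofFinite G
  rw [Nat.card_eq_fintype_card] at hR
  have : NeZero (Nat.card G : R) := ⟨by rwa [Nat.card_eq_fintype_card]⟩
  have : IsSemisimpleRing (MonoidAlgebra R G) := inferInstance
  obtain ⟨e, he⟩ : ∃ e, e = (Fintype.card G : R)⁻¹ • ∑ g, of R G g := ⟨_, rfl⟩
  have hleft : ∀ g, of R G g * e = e := fun g => by
    rw [he, mul_smul_comm, Finset.mul_sum]
    simp_rw [← map_mul]
    exact congrArg _ (Fintype.sum_equiv (Equiv.mulLeft g) _ _ fun _ => rfl)
  have hright : ∀ g, e * of R G g = e := fun g => by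
    rw [he, smul_mul_assoc, Finset.sum_mul]
    simp_rw [← map_mul]
    exact congrArg _ (Fintype.sum_equiv (Equiv.mulRight g) _ _ fun _ => rfl)
  have hee : e * e = e := by
    nth_rw 1 [he]
    rw [smul_mul_assoc, Finset.sum_mul, Finset.sum_congr rfl fun g _ => hleft g, Finset.sum_const,
      Finset.card_univ, ← Nat.cast_smul_eq_nsmul R, inv_smul_smul₀ hR]
  obtain ⟨r, s, hrs⟩ := exists_mul_add_mul_eq_one hR hxy he hleft hright
  obtain ⟨t, ht⟩ := IsSemisimpleRing.exists_isUnit_add_mul hrs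
  -- With these values the unit `z` satisfies `z * v = e * v = z * (e * v)`. Hence `v = e * v` is
  -- `G`-invariant and `w = (y - 1) * v = 0`.
  refine ⟨e - t, 1, fun v w ha hb => ?_⟩
  rw [one_mul] at hb
  have hew : e * w = 0 := by rw [hb, ← mul_assoc, mul_sub, hright, mul_one, sub_self, zero_mul]
  set z := of R G x - 1 + e + t * (of R G y - 1) with hz
  have hze : z * e = e := by
    rw [hz, add_mul, add_mul, sub_mul, mul_assoc, sub_mul, hleft, hleft, hee]; simp
  have hzv : z * v = z * (e * v) := by
    calc z * v = (of R G x - 1) * v + e * v + t * ((of R G y - 1) * v) := by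
          rw [hz]; noncomm_ring
      _ = z * (e * v) := by
          rw [← ha, ← hb, ← mul_assoc, hze, sub_mul, hew]; abel
  rw [hb, ht.mul_left_cancel hzv, ← mul_assoc, sub_mul, hleft, one_mul, sub_self, zero_mul]

end MonoidAlgebra

/-! ### Two generators for the wreath product -/

namespace RegularWreathProduct

open MonoidAlgebra

/-- The wreath product of `C_q` with a two-generator group of order prime to `q` is generated by two
elements. -/
theorem exists_closure_pair_eq_top {q : ℕ} [Fact q.Prime] {G : Type*} [Group G] [Finite G]
    (hq : (Nat.card G : ZMod q) ≠ 0) {x y : G} (hxy : Subgroup.closure {x, y} = ⊤) :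
    ∃ s t : RegularWreathProduct (Multiplicative (ZMod q)) G, Subgroup.closure {s, t} = ⊤ := by
  have := Fintype.ofFinite G
  obtain ⟨a, b, hab⟩ := exists_forall_eq_zero_of_mul_eq_sub_one_mul hq hxy
  rw [Nat.card_eq_fintype_card] at hq
  have : NeZero (Nat.card G : ZMod q) := ⟨by rwa [Nat.card_eq_fintype_card]⟩
  refine ⟨ofMonoidAlgebra a x, ofMonoidAlgebra b y, ?_⟩
  set K := Subgroup.closure {ofMonoidAlgebra a x, ofMonoidAlgebra b y} with hK
  have haK : ofMonoidAlgebra a x ∈ K := Subgroup.subset_closure (by simp)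
  have hbK : ofMonoidAlgebra b y ∈ K := Subgroup.subset_closure (by simp)
  have hmap : K.map rightHom = ⊤ := by
    rw [hK, MonoidHom.map_closure, Set.image_pair]
    exact hxy
  have hc : ∀ g : G, ∃ c : MonoidAlgebra (ZMod q) G, ofMonoidAlgebra c g ∈ K := by
    intro g
    obtain ⟨k, hk, rfl⟩ : g ∈ K.map rightHom := by rw [hmap]; trivial
    obtain ⟨c, hc⟩ := exists_eq_ofMonoidAlgebra k
    exact ⟨c, by rw [rightHom_eq_right, ← hc]; exact hk⟩
  choose c hc using hc
  let L₀ : AddSubgroup (MonoidAlgebra (ZMod q) G) :=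
    { carrier := {m | ofMonoidAlgebra m 1 ∈ K}
      zero_mem' := by
        change ofMonoidAlgebra 0 1 ∈ K
        rw [ofMonoidAlgebra_zero_one]; exact K.one_mem
      add_mem' := fun {m n} hm hn => by
        have := K.mul_mem hm hn
        rwa [ofMonoidAlgebra_mul, map_one, one_mul, mul_one] at this
      neg_mem' := fun {m} hm => by
        have := K.inv_mem hm
        rwa [ofMonoidAlgebra_inv, inv_one, map_one, one_mul] at this }
  -- `K` maps onto `G`, so conjugation inside `K` makes its intersection with the base a left ideal;
  -- scalars are free over the prime field.
  let L : Submodule (MonoidAlgebra (ZMod q) G) (MonoidAlgebra (ZMod q) G) :=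
    { L₀ with
      smul_mem' := fun r m hm => by
        induction r using MonoidAlgebra.induction_on with
        | of g =>
          have h1 := K.mul_mem (K.mul_mem (hc g) hm) (K.inv_mem (hc g))
          have h2 : ofMonoidAlgebra (c g) g * ofMonoidAlgebra m 1 =
              ofMonoidAlgebra (of (ZMod q) G g * m) 1 * ofMonoidAlgebra (c g) g := by
            rw [ofMonoidAlgebra_mul, ofMonoidAlgebra_mul, map_one, one_mul, mul_one, one_mul,
              add_comm]
          rwa [h2, mul_inv_cancel_right] at h1
        | add r s hr hs => rw [add_smul]; exact L₀.add_mem hr hs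
        | smul k r hr => rw [smul_assoc]; exact ZMod.smul_mem (K := L₀) hr k }
  have hL : ∀ m, m ∈ L ↔ ofMonoidAlgebra m 1 ∈ K := fun m => Iff.rfl
  have hsub : ∀ {m n g}, ofMonoidAlgebra m g ∈ K → ofMonoidAlgebra n g ∈ K → m - n ∈ L := by
    intro m n g hm hn
    have h1 : ofMonoidAlgebra m g = ofMonoidAlgebra (m - n) 1 * ofMonoidAlgebra n g := by
      rw [ofMonoidAlgebra_mul, map_one, one_mul, one_mul, sub_add_cancel]
    rw [hL, ← mul_inv_eq_iff_eq_mul.2 h1]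
    exact K.mul_mem hm (K.inv_mem hn)
  -- `w` is the component of `1` in a complement, so right multiplication by `w` projects along `L`.
  obtain ⟨L', hLL'⟩ := exists_isCompl L
  obtain ⟨l, hl, w, hw, hlw⟩ := Submodule.mem_sup.1
    (show (1 : MonoidAlgebra (ZMod q) G) ∈ L ⊔ L' by rw [hLL'.sup_eq_top]; trivial)
  have hmw : ∀ {m}, m ∈ L → m * w = 0 := by
    intro m hm
    refine (Submodule.disjoint_def.1 hLL'.disjoint) _ ?_ (L'.smul_mem m hw)
    rw [eq_sub_of_add_eq' hlw, mul_sub, mul_one]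
    exact L.sub_mem hm (L.smul_mem m hl)
  have hcw : ∀ {m n g}, ofMonoidAlgebra m g ∈ K → ofMonoidAlgebra n g ∈ K → m * w = n * w :=
    fun hm hn => by rw [← sub_eq_zero, ← sub_mul]; exact hmw (hsub hm hn)
  -- `g ↦ c g * w` is a well-defined derivation; minus its average over `G` shows that it is inner.
  obtain ⟨v, hv⟩ : ∃ v, ∀ g m, ofMonoidAlgebra m g ∈ K → m * w = (of (ZMod q) G g - 1) * v := by
    refine ⟨-((Fintype.card G : ZMod q)⁻¹ • ∑ h, c h * w), fun g m hm => ?_⟩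
    have h1 : ∑ h, c h * w = Fintype.card G • (m * w) + of (ZMod q) G g * ∑ h, c h * w := by
      nth_rw 1 [← Equiv.sum_comp (Equiv.mulLeft g)]
      rw [Finset.mul_sum, ← Finset.card_univ, ← Finset.sum_const, ← Finset.sum_add_distrib]
      refine Finset.sum_congr rfl fun h _ => ?_
      have h2 := K.mul_mem hm (hc h)
      rw [ofMonoidAlgebra_mul] at h2
      rw [Equiv.coe_mulLeft, hcw (hc (g * h)) h2, add_mul, mul_assoc]
    have h3 : m * w = (Fintype.card G : ZMod q)⁻¹ •
        (∑ h, c h * w - of (ZMod q) G g * ∑ h, c h * w) := by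
      nth_rw 1 [h1]
      rw [add_sub_cancel_right, ← Nat.cast_smul_eq_nsmul (ZMod q), inv_smul_smul₀ hq]
    rw [h3, mul_neg, mul_smul_comm, ← smul_neg, sub_mul, one_mul, neg_sub]
  have hw0 : w = 0 := hab v w (hv x a haK) (hv y b hbK)
  have htop : ∀ m, m ∈ L := fun m => by
    have h1 : l = 1 := by rw [← hlw, hw0, add_zero]
    simpa [h1] using L.smul_mem m hl
  refine eq_top_iff.2 fun h _ => ?_
  obtain ⟨m, hm⟩ := exists_eq_ofMonoidAlgebra h
  have h1 : h = ofMonoidAlgebra (m - c h.right) 1 * ofMonoidAlgebra (c h.right) h.right := by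
    rw [ofMonoidAlgebra_mul, map_one, one_mul, one_mul, sub_add_cancel, ← hm]
  rw [h1]
  exact K.mul_mem (htop _) (hc _)

/-! ### Solubility, the exact rank, and the main theorem -/

theorem isSolvable {D Q : Type*} [CommGroup D] [Group Q] [Group.IsSolvable Q] :
    Group.IsSolvable (RegularWreathProduct D Q) := by
  let f : (Q → D) →* RegularWreathProduct D Q :=
    { toFun := fun d => ⟨d, 1⟩
      map_one' := rfl
      map_mul' := fun a b => by ext <;> simp }
  refine Group.isSolvable_of_ker_le_range f rightHom fun h hh => ⟨h.left, ?_⟩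
  exact RegularWreathProduct.ext rfl (Eq.symm hh)

theorem not_commute_of_nontrivial (D Q : Type*) [Group D] [Group Q] [Nontrivial D] [Nontrivial Q] :
    ¬ ∀ a b : RegularWreathProduct D Q, a * b = b * a := by
  classical
  intro h
  obtain ⟨d, hd⟩ := exists_ne (1 : D)
  obtain ⟨g, hg⟩ := exists_ne (1 : Q)
  have := congrFun (congrArg left (h ⟨Pi.mulSingle 1 d, 1⟩ ⟨1, g⟩)) 1
  simp [hg, hd] at this

end RegularWreathProduct

theorem Group.exists_closure_pair_eq_top {G : Type*} [Group G] [Group.FG G]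
    (hG : Group.rank G ≤ 2) : ∃ x y : G, Subgroup.closure {x, y} = ⊤ := by
  obtain ⟨S, hS, htop⟩ := Group.rank_spec G
  rw [← hS] at hG
  interval_cases h : S.card
  · rw [Finset.card_eq_zero] at h
    subst h
    exact ⟨1, 1, by rw [Set.pair_eq_singleton, Subgroup.closure_singleton_one, ← htop]; simp⟩
  · obtain ⟨x, rfl⟩ := Finset.card_eq_one.1 h
    exact ⟨x, x, by simpa using htop⟩
  · classical
    obtain ⟨x, y, -, rfl⟩ := Finset.card_eq_two.1 h
    exact ⟨x, y, by simpa using htop⟩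

theorem Group.two_le_rank_of_not_commute {G : Type*} [Group G] [Group.FG G]
    (hG : ¬ ∀ a b : G, a * b = b * a) : 2 ≤ Group.rank G := by
  by_contra! hlt
  obtain ⟨S, hS, htop⟩ := Group.rank_spec G
  rw [← hS] at hlt
  have hcomm : ∀ x ∈ (S : Set G), ∀ y ∈ (S : Set G), x * y = y * x := fun x hx y hy => by
    rw [Finset.card_le_one.1 (Nat.le_of_lt_succ hlt) x hx y hy]
  have := Subgroup.isMulCommutative_closure hcomm
  rw [htop] at this
  exact hG fun a b => congrArg Subtype.val
    (this.is_comm.comm (⟨a, trivial⟩ : (⊤ : Subgroup G)) ⟨b, trivial⟩)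

theorem theorem3p1 (G : Type u) [Group G] [Finite G] [Group.IsSolvable G]
    (hG : Group.rank G ≤ 2)
    (p : ℕ) (hp : IsLeast (primesDividingOrder G) p) :
    (p : ℕ∞) ≤ invariableRank G ∨
      ∃ (H : Type u) (_ : Group H) (_ : Finite H),
        Group.IsSolvable H ∧
        (∃ f : H →* G, Function.Surjective f) ∧
        Group.rank H = 2 ∧
        invariableRank G < invariableRank H ∧
        IsLeast (primesDividingOrder H) p ∧
        ∃ q : ℕ, q.Prime ∧ p < q ∧
          Nonempty (H ≃* RegularWreathProduct (Multiplicative (ZMod q)) G) := by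
  refine or_iff_not_imp_left.2 fun hlt => ?_
  rw [not_le] at hlt
  -- Taking `q > |G|` ensures both `q ∤ |G|` and `p < q`.
  obtain ⟨q, hqG, hq⟩ := Nat.exists_infinite_primes (Nat.card G + 1)
  have : Fact q.Prime := ⟨hq⟩
  have hcard : 0 < Nat.card G := Nat.card_pos
  have hpq : p < q := (Nat.le_of_dvd hcard hp.1.2).trans_lt hqG
  have hR : (Nat.card G : ZMod q) ≠ 0 := fun h =>
    absurd (Nat.le_of_dvd hcard ((ZMod.natCast_eq_zero_iff _ _).1 h)) (by omega)
  have : Nontrivial G := Finite.one_lt_card_iff_nontrivial.1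
    (hp.1.1.one_lt.trans_le (Nat.le_of_dvd hcard hp.1.2))
  have hord : ∀ g : G, g ≠ 1 → p ≤ orderOf g := fun g hg => by
    have h1 : orderOf g ≠ 1 := fun h => hg (orderOf_eq_one_iff.1 h)
    exact (hp.2 ⟨Nat.minFac_prime h1, (Nat.minFac_dvd _).trans (orderOf_dvd_natCard g)⟩).trans
      (Nat.minFac_le (orderOf_pos g))
  refine ⟨RegularWreathProduct (Multiplicative (ZMod q)) G, inferInstance, inferInstance,
    RegularWreathProduct.isSolvable, ⟨RegularWreathProduct.rightHom,
      fun g => ⟨RegularWreathProduct.inl g, rfl⟩⟩, le_antisymm ?_ ?_,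
    RegularWreathProduct.invariableRank_lt hR hord hlt, ⟨⟨hp.1.1, ?_⟩, ?_⟩,
    q, hq, hpq, ⟨MulEquiv.refl _⟩⟩
  · obtain ⟨x, y, hxy⟩ := Group.exists_closure_pair_eq_top hG
    obtain ⟨s, t, hst⟩ := RegularWreathProduct.exists_closure_pair_eq_top hR hxy
    classical
    exact (Group.rank_le (S := {s, t}) (by simpa using hst)).trans Finset.card_le_two
  · exact Group.two_le_rank_of_not_commute (RegularWreathProduct.not_commute_of_nontrivial _ _)
  · rw [RegularWreathProduct.card]
    exact hp.1.2.mul_left _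
  · rintro r ⟨hr, hrd⟩
    rw [RegularWreathProduct.card, hr.dvd_mul] at hrd
    rcases hrd with h | h
    · rw [Nat.card_congr Multiplicative.toAdd, Nat.card_zmod] at h
      rw [(Nat.prime_dvd_prime_iff_eq hr hq).1 (hr.dvd_of_dvd_pow h)]
      exact hpq.le
    · exact hp.2 ⟨hr, h⟩
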